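/- Let $2^{\omega}$ carry the standard product (coin-tossing) probability measure. For each $k<\omega$ let $\varphi_k:\omega\to\omega$ be a function with $$\varphi_k(0)=2^{k+4},\qquad \varphi_k(i+1)>2^{2^{k+3}}+\varphi_k(i)+\frac{2^{2k+7}}{\log_2\bigl(1+2^{-2^{2k+7}}\bigr)}\quad(i<\omega),$$ and let $N_k=2^{1+\lfloor\log_2(\varphi_k(k+1))\rfloor}$. Regard $N_k$ as the set $\{0,\dots,N_k-1\}$, let $\prod_{k<\omega}N_k$ carry the product topology and the product of the uniform probability measures on the factors, and give products of two of these spaces the product measure. "Measurable" means Lebesgue measurable, i.e. measurable with respect to the completion of the relevant measure. A function $f:\mathbb R\times\mathbb R\to\mathbb R$ is called sup-measurable if for every Lebesgue measurable $g:\mathbb R\to\mathbb R$ the function $x\mapsto f(x,g(x))$ is Lebesgue measurable. Then the following conditions are equivalent: 1. Every sup-measurable function $f:\mathbb R\times\mathbb R\to\mathbb R$ is Lebesgue measurable. 2. For every non-measurable set $A\subseteq\mathbb R\times\mathbb R$ there is a Borel function $f:\mathbb R\to\mathbb R$ such that the set $\{x\in\mathbb R:(x,f(x))\in A\}$ is not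 measurable. 3. For every non-measurable set $A\subseteq 2^{\omega}\times 2^{\omega}$ there is a Borel function $f:2^{\omega}\to 2^{\omega}$ such that the set $\{x\in 2^{\omega}:(x,f(x))\in A\}$ is not measurable. 4. For every set $A\subseteq\prod_{k<\omega}N_k\times 2^{\omega}$ of outer measure one and inner measure zero there is a Borel function $h:\prod_{k<\omega}N_k\to 2^{\omega}$ such that the set $\{x\in\prod_{k<\omega}N_k:(x,h(x))\in A\}$ is not measurable. -/

import Mathlib

open MeasureTheory

/-- `f : ℝ² → ℝ` is superposition-measurable if `x ↦ f (x, g x)` is Lebesgue measurable for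
every Lebesgue measurable `g : ℝ → ℝ`. (`NullMeasurable h volume` says that preimages under `h`
of Borel sets are Lebesgue measurable, that is, measurable for the completed measure.) -/
def SupMeasurable (f : ℝ × ℝ → ℝ) : Prop :=
  ∀ g : ℝ → ℝ, NullMeasurable g volume → NullMeasurable (fun x => f (x, g x)) volume

/-- The standard product measure on `∏ k, X k`, each finite non-empty factor carrying the
uniform probability measure. -/
noncomputable def uniformProduct (X : ℕ → Type) [∀ k, Fintype (X k)] [∀ k, Nonempty (X k)]
    [∀ k, MeasurableSpace (X k)] : Measure (∀ k, X k) :=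
  Measure.infinitePi fun k => (PMF.uniformOfFintype (X k)).toMeasure

/-- The Cantor space `2^ω`. Its product `σ`-algebra is its Borel `σ`-algebra. -/
abbrev CantorSpace : Type := ℕ → Bool

/-- The standard (coin-tossing) measure on the Cantor space. -/
noncomputable def cantorMeasure : Measure CantorSpace := uniformProduct fun _ => Bool

/-- The inner measure of an arbitrary set. (The outer measure of `A` is `μ A`.) -/
noncomputable def innerMeasure {X : Type*} [MeasurableSpace X] (μ : Measure X) (A : Set X) :
    ENNReal :=
  ⨆ (B : Set X) (_ : MeasurableSet B) (_ : B ⊆ A), μ B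

/-- The requirements on the functions `φ k : ℕ → ℕ`. -/
structure IsGrowthSystem (φ : ℕ → ℕ → ℕ) : Prop where
  zero : ∀ k, φ k 0 = 2 ^ (k + 4)
  succ : ∀ k i, (2 : ℝ) ^ (2 ^ (k + 3)) + φ k i +
      2 ^ (2 * k + 7) / Real.logb 2 (1 + ((2 : ℝ) ^ (2 ^ (2 * k + 7)))⁻¹) < φ k (i + 1)

/-- `N_k = 2 ^ (1 + ⌊log₂ (φ_k (k + 1))⌋)`. -/
noncomputable def sideLength (φ : ℕ → ℕ → ℕ) (k : ℕ) : ℕ :=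
  2 ^ (1 + ⌊Real.logb 2 (φ k (k + 1))⌋₊)

instance sideLength_neZero (φ : ℕ → ℕ → ℕ) (k : ℕ) : NeZero (sideLength φ k) :=
  ⟨pow_ne_zero _ two_ne_zero⟩

/-- The space `∏ k, N_k`, where `N_k` is thought of as the set `{0, …, N_k - 1}`. Its product
`σ`-algebra is its Borel `σ`-algebra. -/
abbrev BoxSpace (φ : ℕ → ℕ → ℕ) : Type := ∀ k, Fin (sideLength φ k)

/-- The standard product measure on `∏ k, N_k`. -/
noncomputable def boxMeasure (φ : ℕ → ℕ → ℕ) : Measure (BoxSpace φ) :=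
  uniformProduct fun k => Fin (sideLength φ k)

open Set Filter Topology ProbabilityTheory

/-! In contrapositive form, conditions 2 and 3 say that a set with measurable sections along all
Borel functions (`GraphMeasurable`) is measurable; condition 1 reduces to this via indicators and
preimages. The property depends only on the measure classes of the two factors, because isomorphisms
conjugate Borel functions (`GraphMeasurable.transfer`), and all factors here are isomorphic modulo
null sets (`nonempty_aeIso`, `nonempty_aeIso_volume`).

The substance is 4 → 2: a counterexample must be improved to one of outer measure one and inner
measure zero. On the torus, translations respect the product structure. A non-measurable set is
bithick relative to some `B` of positive measure; by ergodicity countably many translates of `B`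
cover almost everything, and patching the translated pieces gives a bithick set that is still graph
measurable (`exists_bithick_graphMeasurable_torus`). -/

/-- An isomorphism of measure classes: measurable maps in both directions that preserve null sets
and are inverse to each other almost everywhere. -/
structure AEIso {X Y : Type*} [MeasurableSpace X] [MeasurableSpace Y] (μ : Measure X)
    (ν : Measure Y) where
  toFun : X → Y
  invFun : Y → X
  qmp_toFun : Measure.QuasiMeasurePreserving toFun μ ν
  qmp_invFun : Measure.QuasiMeasurePreserving invFun ν μ
  left_inv : ∀ᵐ x ∂μ, invFun (toFun x) = x
  right_inv : ∀ᵐ y ∂ν, toFun (invFun y) = y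

namespace AEIso

variable {X Y Z W : Type*} [MeasurableSpace X] [MeasurableSpace Y] [MeasurableSpace Z]
  [MeasurableSpace W] {μ : Measure X} {ν : Measure Y} {ρ : Measure Z} {τ : Measure W}

/-- The inverse isomorphism. -/
def symm (e : AEIso μ ν) : AEIso ν μ :=
  ⟨e.invFun, e.toFun, e.qmp_invFun, e.qmp_toFun, e.right_inv, e.left_inv⟩

/-- Composition of isomorphisms. -/
def trans (e : AEIso μ ν) (f : AEIso ν ρ) : AEIso μ ρ where
  toFun := f.toFun ∘ e.toFun
  invFun := e.invFun ∘ f.invFun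
  qmp_toFun := f.qmp_toFun.comp e.qmp_toFun
  qmp_invFun := e.qmp_invFun.comp f.qmp_invFun
  left_inv := by
    filter_upwards [e.qmp_toFun.ae f.left_inv, e.left_inv] with x h1 h2
    simp [h1, h2]
  right_inv := by
    filter_upwards [f.qmp_invFun.ae e.right_inv, f.right_inv] with x h1 h2
    simp [h1, h2]

/-- Mutually absolutely continuous measures have isomorphic measure classes. -/
def ofAbsolutelyContinuous {ν' : Measure X} (h : μ ≪ ν') (h' : ν' ≪ μ) : AEIso μ ν' where
  toFun := id
  invFun := id
  qmp_toFun := ⟨measurable_id, by simpa using h⟩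
  qmp_invFun := ⟨measurable_id, by simpa using h'⟩
  left_inv := by simp
  right_inv := by simp

/-- The product of two isomorphisms. -/
def prodMap [SFinite μ] [SFinite ν] [SFinite ρ] [SFinite τ] (e : AEIso μ ν) (f : AEIso ρ τ) :
    AEIso (μ.prod ρ) (ν.prod τ) where
  toFun := Prod.map e.toFun f.toFun
  invFun := Prod.map e.invFun f.invFun
  qmp_toFun := QuasiMeasurePreserving.prodMap e.qmp_toFun f.qmp_toFun
  qmp_invFun := QuasiMeasurePreserving.prodMap e.qmp_invFun f.qmp_invFun
  left_inv := by
    filter_upwards [Measure.quasiMeasurePreserving_fst.ae e.left_inv,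
      Measure.quasiMeasurePreserving_snd.ae f.left_inv] with x h1 h2
    exact Prod.ext h1 h2
  right_inv := by
    filter_upwards [Measure.quasiMeasurePreserving_fst.ae e.right_inv,
      Measure.quasiMeasurePreserving_snd.ae f.right_inv] with x h1 h2
    exact Prod.ext h1 h2

lemma preimage_preimage_ae_eq (e : AEIso μ ν) (A : Set X) :
    e.toFun ⁻¹' (e.invFun ⁻¹' A) =ᵐ[μ] A := by
  rw [eventuallyEq_set]
  filter_upwards [e.left_inv] with x hx
  simp [hx]

lemma nullMeasurableSet_preimage_invFun_iff (e : AEIso μ ν) {A : Set X} :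
    NullMeasurableSet (e.invFun ⁻¹' A) ν ↔ NullMeasurableSet A μ :=
  ⟨fun h => (h.preimage e.qmp_toFun).congr (e.preimage_preimage_ae_eq A),
    fun h => h.preimage e.qmp_invFun⟩

end AEIso

/-! ### Graph measurable and bithick sets under isomorphism -/

/-- The section of `A` along every measurable function is measurable. -/
def GraphMeasurable {X Y : Type*} [MeasurableSpace X] [MeasurableSpace Y] (μ : Measure X)
    (A : Set (X × Y)) : Prop :=
  ∀ f : X → Y, Measurable f → NullMeasurableSet {x | (x, f x) ∈ A} μ

/-- Neither `A` nor its complement contains a measurable set of positive measure. -/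
def Bithick {X : Type*} [MeasurableSpace X] (μ : Measure X) (A : Set X) : Prop :=
  ∀ C : Set X, MeasurableSet C → C ⊆ A ∨ C ⊆ Aᶜ → μ C = 0

section Transfer

variable {X Y Z W : Type*} [MeasurableSpace X] [MeasurableSpace Y] [MeasurableSpace Z]
  [MeasurableSpace W] {μ : Measure X} {ν : Measure Y} {ρ : Measure Z} {τ : Measure W}

/-- Conjugating `g` to `f.invFun ∘ g ∘ e.toFun` turns one section into the other wherever `e.toFun`
undoes `e.invFun`; on the second factor no inverse law is needed. -/
lemma GraphMeasurable.transfer (e : AEIso μ ν) (f : AEIso ρ τ) {A : Set (X × Z)}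
    (hA : GraphMeasurable μ A) : GraphMeasurable ν (Prod.map e.invFun f.invFun ⁻¹' A) := by
  intro g hg
  have h := (hA (f.invFun ∘ g ∘ e.toFun) (f.qmp_invFun.measurable.comp
    (hg.comp e.qmp_toFun.measurable))).preimage e.qmp_invFun
  refine h.congr ?_
  rw [eventuallyEq_set]
  filter_upwards [e.right_inv] with y hy
  simp [hy]

lemma Bithick.transfer (e : AEIso μ ν) {A : Set X} (hA : Bithick μ A) :
    Bithick ν (e.invFun ⁻¹' A) := by
  intro C hC hCA
  obtain ⟨N, hN, hNm, hN0⟩ := exists_measurable_superset_of_null (ae_iff.1 e.left_inv)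
  have h0 : μ (e.toFun ⁻¹' C) = 0 := by
    -- Off `N` the left inverse law is exact, so the inclusion of `C` pulls back to a genuine
    -- inclusion.
    have h1 : μ (e.toFun ⁻¹' C \ N) = 0 := by
      refine hA _ ((e.qmp_toFun.measurable hC).diff hNm) ?_
      have key : ∀ x ∈ e.toFun ⁻¹' C \ N, e.invFun (e.toFun x) = x := by
        intro x hx
        by_contra h
        exact hx.2 (hN h)
      refine hCA.imp (fun h x hx => ?_) (fun h x hx => ?_)
      · have := h hx.1
        rwa [mem_preimage, key x hx] at this
      · have := h hx.1
        rwa [← preimage_compl, mem_preimage, key x hx] at this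
    exact measure_mono_null (subset_sdiff_union _ N) (measure_union_null h1 hN0)
  exact (measure_congr (e.symm.preimage_preimage_ae_eq C)).symm.trans
    (e.qmp_invFun.preimage_null h0)

lemma graphMeasurable_imp_nullMeasurableSet_transfer [SFinite μ] [SFinite ν] [SFinite ρ]
    [SFinite τ] (e : AEIso μ ν) (f : AEIso ρ τ)
    (h : ∀ A : Set (X × Z), GraphMeasurable μ A → NullMeasurableSet A (μ.prod ρ))
    (A : Set (Y × W)) (hA : GraphMeasurable ν A) : NullMeasurableSet A (ν.prod τ) :=
  (e.prodMap f).symm.nullMeasurableSet_preimage_invFun_iff.1 (h _ (hA.transfer e.symm f.symm))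

lemma Bithick.measure_eq_one [IsProbabilityMeasure μ] {A : Set X} (hA : Bithick μ A) :
    μ A = 1 := by
  rw [← measure_toMeasurable, ← prob_compl_eq_zero_iff (measurableSet_toMeasurable μ A)]
  exact hA _ (measurableSet_toMeasurable μ A).compl
    (Or.inr (compl_subset_compl.2 (subset_toMeasurable μ A)))

lemma Bithick.innerMeasure_eq_zero {A : Set X} (hA : Bithick μ A) : innerMeasure μ A = 0 := by
  simp only [innerMeasure, ENNReal.iSup_eq_zero]
  exact fun C hC hCA => hA C hC (Or.inl hCA)

lemma not_nullMeasurableSet_of_innerMeasure_lt {A : Set X} (h : innerMeasure μ A < μ A) :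
    ¬ NullMeasurableSet A μ := by
  intro hA
  obtain ⟨B, hBA, hB, hBe⟩ := hA.exists_measurable_subset_ae_eq
  refine h.not_ge ?_
  rw [← measure_congr hBe]
  exact le_iSup₂_of_le B hB (le_iSup_of_le hBA le_rfl)

/-- A non-measurable set is, on some measurable set of positive measure, non-measurable in the
strongest sense. -/
lemma exists_measurableSet_relatively_bithick [SFinite μ] {A : Set X}
    (hA : ¬ NullMeasurableSet A μ) :
    ∃ B, MeasurableSet B ∧ μ B ≠ 0 ∧
      ∀ C, MeasurableSet C → C ⊆ B → C ⊆ A ∨ C ⊆ Aᶜ → μ C = 0 := by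
  -- Were the two hulls to meet in a null set, `A` would agree almost everywhere with its own hull.
  refine ⟨toMeasurable μ A ∩ toMeasurable μ Aᶜ,
    (measurableSet_toMeasurable _ _).inter (measurableSet_toMeasurable _ _), fun h0 => hA ?_, ?_⟩
  · refine ((measurableSet_toMeasurable μ A).nullMeasurableSet).congr ?_
    refine ae_eq_set.2 ⟨measure_mono_null (fun x hx => ?_) h0, ?_⟩
    · exact ⟨hx.1, subset_toMeasurable _ _ hx.2⟩
    · rw [sdiff_eq_empty.2 (subset_toMeasurable _ _), measure_empty]
  · have key : ∀ D C : Set X, MeasurableSet C → C ⊆ toMeasurable μ D → C ⊆ Dᶜ → μ C = 0 := by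
      intro D C hC h1 h2
      have h := Measure.measure_toMeasurable_inter_of_sFinite (μ := μ) hC D
      rwa [inter_eq_right.2 h1, (disjoint_left.2 fun x hx hc => h2 hc hx : Disjoint D C).inter_eq,
        measure_empty] at h
    rintro C hC hCB (h | h)
    · exact key Aᶜ C hC (hCB.trans inter_subset_right) (by simpa using h)
    · exact key A C hC (hCB.trans inter_subset_left) h

end Transfer

/-! ### Atomless standard Borel probability spaces are isomorphic -/

section Quantile

lemma continuous_cdf (ν : Measure ℝ) [IsProbabilityMeasure ν] [NullSingletonClass ν] :
    Continuous (cdf ν) := by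
  refine continuous_iff_continuousAt.2 fun x => ?_
  rw [(cdf ν).mono.continuousAt_iff_leftLim_eq_rightLim, StieltjesFunction.rightLim_eq]
  have h := (cdf ν).measure_singleton x
  rw [measure_cdf, measure_singleton, eq_comm, ENNReal.ofReal_eq_zero] at h
  exact le_antisymm ((cdf ν).mono.leftLim_le le_rfl) (by linarith)

/-- Uniform measure on the open unit interval. -/
noncomputable def uniformIoo : Measure ℝ := volume.restrict (Ioo 0 1)

instance : IsProbabilityMeasure uniformIoo := ⟨by simp [uniformIoo]⟩

lemma uniformIoo_Iic {a : ℝ} (h1 : a ≤ 1) :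
    uniformIoo (Iic a) = ENNReal.ofReal a := by
  rw [uniformIoo, Measure.restrict_congr_set Ioo_ae_eq_Icc, Measure.restrict_apply measurableSet_Iic,
    inter_comm, show Icc (0 : ℝ) 1 ∩ Iic a = Icc 0 a by ext; simp; grind, Real.volume_Icc, sub_zero]

/-- The quantile function of an atomless distribution transports the uniform measure to it and is
a right inverse of the distribution function. -/
lemma exists_quantile (ν : Measure ℝ) [IsProbabilityMeasure ν] [NullSingletonClass ν] :
    ∃ G : ℝ → ℝ, Measurable G ∧ uniformIoo.map G = ν ∧ ∀ u ∈ Ioo (0 : ℝ) 1, cdf ν (G u) = u := by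
  classical
  set F := cdf ν with hF
  have hc : Continuous F := continuous_cdf ν
  have hmem : ∀ u ∈ Ioo (0 : ℝ) 1, (∃ x, F x < u) ∧ ∃ x, u < F x := fun u hu =>
    ⟨((tendsto_cdf_atBot ν).eventually (gt_mem_nhds hu.1)).exists,
      ((tendsto_cdf_atTop ν).eventually (lt_mem_nhds hu.2)).exists⟩
  have hbdd : ∀ u ∈ Ioo (0 : ℝ) 1, BddBelow {x | u ≤ F x} := by
    intro u hu
    obtain ⟨a, ha⟩ := (hmem u hu).1
    exact ⟨a, fun x hx => le_of_not_gt fun hxa => (ha.trans_le hx).not_ge (F.mono hxa.le)⟩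
  have hin : ∀ u ∈ Ioo (0 : ℝ) 1, u ≤ F (sInf {x | u ≤ F x}) := by
    intro u hu
    obtain ⟨b, hb⟩ := (hmem u hu).2
    exact (isClosed_le continuous_const hc).csInf_mem ⟨b, hb.le⟩ (hbdd u hu)
  have hgal : ∀ u ∈ Ioo (0 : ℝ) 1, ∀ x, sInf {x | u ≤ F x} ≤ x ↔ u ≤ F x := fun u hu x =>
    ⟨fun h => (hin u hu).trans (F.mono h), fun h => csInf_le (hbdd u hu) h⟩
  let G : ℝ → ℝ := fun u => if u ∈ Ioo (0 : ℝ) 1 then sInf {x | u ≤ F x} else 0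
  have hG : ∀ u ∈ Ioo (0 : ℝ) 1, G u = sInf {x | u ≤ F x} := fun u hu => if_pos hu
  have hpre : ∀ x, G ⁻¹' Iic x ∩ Ioo 0 1 = Iic (F x) ∩ Ioo 0 1 := by
    intro x
    ext u
    refine and_congr_left fun hu => ?_
    rw [mem_preimage, mem_Iic, hG u hu, hgal u hu, mem_Iic]
  have hGm : Measurable G := by
    refine measurable_of_Iic fun x => ?_
    rw [← inter_union_sdiff (G ⁻¹' Iic x) (Ioo 0 1), hpre]
    refine (measurableSet_Iic.inter measurableSet_Ioo).union ?_
    by_cases hx : 0 ≤ x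
    · convert! (measurableSet_Ioo (a := (0 : ℝ)) (b := 1)).compl using 1
      ext u
      by_cases hu : u ∈ Ioo (0 : ℝ) 1
      · simp only [Set.mem_sdiff, mem_compl_iff, hu, not_true, and_false]
      · simp only [Set.mem_sdiff, mem_compl_iff, mem_preimage, mem_Iic, G, hx, hu, not_false_eq_true,
          if_false, and_self]
    · convert! MeasurableSet.empty using 1
      refine eq_empty_of_forall_notMem fun u hu => ?_
      have h := hu.1
      rw [mem_preimage, mem_Iic] at h
      simp only [G, if_neg hu.2] at h
      exact hx h
  refine ⟨G, hGm, ?_, fun u hu => ?_⟩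
  · have : IsProbabilityMeasure (uniformIoo.map G) :=
      Measure.isProbabilityMeasure_map hGm.aemeasurable
    refine Measure.ext_of_Iic _ _ fun x => ?_
    rw [Measure.map_apply hGm measurableSet_Iic, ← ofReal_cdf ν x,
      ← uniformIoo_Iic (cdf_le_one ν x), uniformIoo,
      Measure.restrict_apply (hGm measurableSet_Iic), hpre, Measure.restrict_apply measurableSet_Iic]
  · rw [hG u hu]
    refine le_antisymm ?_ (hin u hu)
    -- Left of the infimum `F` stays at most `u`, so left continuity, hence atomlessness, excludes a
    -- jump over `u`.
    refine le_of_tendsto (hc.continuousWithinAt (s := Iio (sInf {x | u ≤ F x})))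
      (eventually_nhdsWithin_of_forall fun y hy => ?_)
    exact le_of_not_ge fun h => (not_le.2 (mem_Iio.1 hy)) ((hgal u hu y).2 h)

end Quantile

/-- Every atomless Borel probability measure is isomorphic to the uniform measure. -/
lemma nonempty_aeIso_uniformIoo {X : Type*} [MeasurableSpace X] [StandardBorelSpace X]
    (μ : Measure X) [IsProbabilityMeasure μ] [NullSingletonClass μ] :
    Nonempty (AEIso μ uniformIoo) := by
  have : Nonempty X := nonempty_of_isProbabilityMeasure μ
  have he := measurableEmbedding_embeddingReal X
  set e := embeddingReal X
  have : IsProbabilityMeasure (μ.map e) :=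
    Measure.isProbabilityMeasure_map he.measurable.aemeasurable
  have : NullSingletonClass (μ.map e) := ⟨fun x => by
    rw [Measure.map_apply he.measurable (measurableSet_singleton x)]
    exact (Set.subsingleton_singleton.preimage he.injective).measure_zero μ⟩
  obtain ⟨G, hGm, hGmap, hGF⟩ := exists_quantile (μ.map e)
  have hFm : Measurable (cdf (μ.map e)) := (cdf (μ.map e)).mono.measurable
  have hT : Measurable (cdf (μ.map e) ∘ e) := hFm.comp he.measurable
  have hS : Measurable (he.invFun ∘ G) := he.measurable_invFun.comp hGm
  have hSmap : uniformIoo.map (he.invFun ∘ G) = μ := by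
    rw [← Measure.map_map he.measurable_invFun hGm, hGmap,
      Measure.map_map he.measurable_invFun he.measurable, he.leftInverse_invFun.comp_eq_id,
      Measure.map_id]
  have hrange : ∀ᵐ u ∂uniformIoo, G u ∈ range e := by
    refine ae_of_ae_map hGm.aemeasurable (p := fun y => y ∈ range e) ?_
    rw [hGmap]
    exact (ae_map_iff he.measurable.aemeasurable he.measurableSet_range).2 (by simp)
  have hright : ∀ᵐ u ∂uniformIoo, (cdf (μ.map e) ∘ e) ((he.invFun ∘ G) u) = u := by
    filter_upwards [hrange, ae_restrict_mem measurableSet_Ioo] with u ⟨x, hx⟩ hu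
    rw [Function.comp_apply, Function.comp_apply, ← hx, he.leftInverse_invFun x, hx, hGF u hu]
  have hTmap : μ.map (cdf (μ.map e) ∘ e) = uniformIoo := by
    calc μ.map (cdf (μ.map e) ∘ e) = (uniformIoo.map (he.invFun ∘ G)).map (cdf (μ.map e) ∘ e) := by
          rw [hSmap]
      _ = uniformIoo.map id := by
          rw [Measure.map_map hT hS]
          exact Measure.map_congr hright
      _ = uniformIoo := Measure.map_id
  refine ⟨⟨cdf (μ.map e) ∘ e, he.invFun ∘ G, ⟨hT, hTmap.le.absolutelyContinuous⟩,
    ⟨hS, hSmap.le.absolutelyContinuous⟩, ?_, hright⟩⟩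
  -- The right inverse law, pushed forward along the quantile map, yields the left one.
  have hleft : ∀ᵐ x ∂uniformIoo.map (he.invFun ∘ G),
      (he.invFun ∘ G) ((cdf (μ.map e) ∘ e) x) = x := by
    refine (ae_map_iff hS.aemeasurable (measurableSet_eq_fun (hS.comp hT) measurable_id)).2 ?_
    filter_upwards [hright] with u hu
    exact congrArg _ hu
  rwa [hSmap] at hleft

lemma nonempty_aeIso {X Y : Type*} [MeasurableSpace X] [StandardBorelSpace X] [MeasurableSpace Y]
    [StandardBorelSpace Y] (μ : Measure X) [IsProbabilityMeasure μ] [NullSingletonClass μ]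
    (ν : Measure Y) [IsProbabilityMeasure ν] [NullSingletonClass ν] : Nonempty (AEIso μ ν) :=
  (nonempty_aeIso_uniformIoo μ).elim fun e =>
    (nonempty_aeIso_uniformIoo ν).map fun f => e.trans f.symm

/-- A Gaussian is an atomless probability measure in the measure class of `volume`. -/
lemma nonempty_aeIso_volume {X : Type*} [MeasurableSpace X] [StandardBorelSpace X]
    (μ : Measure X) [IsProbabilityMeasure μ] [NullSingletonClass μ] :
    Nonempty (AEIso μ (volume : Measure ℝ)) :=
  have := nullSingletonClass_gaussianReal (μ := 0) (v := 1) one_ne_zero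
  (nonempty_aeIso μ (gaussianReal 0 1)).map fun e => e.trans <|
    .ofAbsolutelyContinuous (gaussianReal_absolutelyContinuous 0 one_ne_zero)
      (gaussianReal_absolutelyContinuous' 0 one_ne_zero)

/-! ### Product measures without atoms -/

section UniformProduct

variable (X : ℕ → Type) [∀ k, Fintype (X k)] [∀ k, Nonempty (X k)] [∀ k, MeasurableSpace (X k)]

instance : IsProbabilityMeasure (uniformProduct X) := by
  unfold uniformProduct
  infer_instance

lemma nullSingletonClass_uniformProduct [∀ k, MeasurableSingletonClass (X k)]
    (h : ∀ k, 2 ≤ Fintype.card (X k)) : NullSingletonClass (uniformProduct X) := by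
  refine ⟨fun x => ?_⟩
  have hle : ∀ n : ℕ, uniformProduct X {x} ≤ (2⁻¹ : ENNReal) ^ n := by
    intro n
    calc uniformProduct X {x}
        ≤ uniformProduct X (Set.pi (Finset.range n) fun k => {x k}) :=
          measure_mono (by rintro y rfl k -; rfl)
      _ = ∏ k ∈ Finset.range n, (PMF.uniformOfFintype (X k)).toMeasure {x k} :=
          Measure.infinitePi_pi _ fun k _ => measurableSet_singleton _
      _ ≤ ∏ _k ∈ Finset.range n, (2⁻¹ : ENNReal) := by
          refine Finset.prod_le_prod' fun k _ => ?_
          rw [PMF.toMeasure_apply_singleton _ _ (measurableSet_singleton _),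
            PMF.uniformOfFintype_apply]
          exact ENNReal.inv_le_inv.2 (by exact_mod_cast h k)
      _ = _ := by simp
  refine le_antisymm (ge_of_tendsto' (ENNReal.tendsto_pow_atTop_nhds_zero_of_lt_one ?_) hle) bot_le
  exact ENNReal.inv_lt_one.2 (by norm_num)

end UniformProduct

instance : IsProbabilityMeasure cantorMeasure := by unfold cantorMeasure; infer_instance

instance : NullSingletonClass cantorMeasure :=
  nullSingletonClass_uniformProduct _ fun _ => by simp

instance (φ : ℕ → ℕ → ℕ) : IsProbabilityMeasure (boxMeasure φ) := by
  unfold boxMeasure; infer_instance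

instance (φ : ℕ → ℕ → ℕ) : NullSingletonClass (boxMeasure φ) :=
  nullSingletonClass_uniformProduct _ fun k => by
    rw [Fintype.card_fin, sideLength, pow_add, pow_one]
    exact Nat.le_mul_of_pos_right 2 (by positivity)

/-! ### Ergodicity and patching on the torus -/

lemma aeconst_of_dense_setOf_preimage_add_eq {G : Type*} [AddCommGroup G] [TopologicalSpace G]
    [IsTopologicalAddGroup G] [MeasurableSpace G] [BorelSpace G] [MeasurableAdd₂ G] {μ : Measure G}
    [IsFiniteMeasure μ] [μ.InnerRegular] [μ.IsAddLeftInvariant] {s : Set G}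
    (hs : NullMeasurableSet s μ) (hd : Dense {g : G | (g + ·) ⁻¹' s = s}) :
    EventuallyConst s (ae μ) :=
  aeconst_of_dense_setOfPred_preimage_vadd_eq hs hd

instance : IsProbabilityMeasure (volume : Measure UnitAddCircle) := ⟨by simp⟩

instance : NullSingletonClass (volume : Measure UnitAddCircle) := ⟨fun x => by
  have h := AddCircle.volume_closedBall (T := 1) (x := x) 0
  rwa [Metric.closedBall_zero, mul_zero, min_eq_right zero_le_one, ENNReal.ofReal_zero] at h⟩

instance : (volume : Measure (UnitAddCircle × UnitAddCircle)).IsAddLeftInvariant :=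
  inferInstanceAs ((volume : Measure UnitAddCircle).prod volume).IsAddLeftInvariant

lemma denseRange_rat_unitAddCircle : DenseRange fun q : ℚ => ((q : ℝ) : UnitAddCircle) :=
  (QuotientAddGroup.mk_surjective.denseRange).comp Rat.denseRange_cast
    (AddCircle.continuous_mk' 1)

/-- Countably many translates of a set of positive measure cover almost all of the torus. -/
lemma exists_translates_cover_torus {B : Set (UnitAddCircle × UnitAddCircle)}
    (hB : MeasurableSet B) (hB0 : volume B ≠ 0) :
    ∃ g : ℕ → UnitAddCircle × UnitAddCircle, ∀ᵐ z, ∃ n, z - g n ∈ B := by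
  let ι : ℚ × ℚ → UnitAddCircle × UnitAddCircle := Prod.map (fun q => ((q : ℝ) : UnitAddCircle))
    fun q => ((q : ℝ) : UnitAddCircle)
  have hι : DenseRange ι := denseRange_rat_unitAddCircle.prodMap denseRange_rat_unitAddCircle
  have hsub : ∀ p q, ι (p - q) = ι p - ι q := fun p q => by simp [ι, Prod.map]
  let U : Set (UnitAddCircle × UnitAddCircle) := ⋃ q, (fun z => z - ι q) ⁻¹' B
  have hU : MeasurableSet U := .iUnion fun q => measurable_id.sub_const _ hB
  have hinv : ∀ q, (ι q + ·) ⁻¹' U = U := by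
    intro q
    ext z
    simp only [U, mem_preimage, mem_iUnion]
    constructor
    · rintro ⟨p, hp⟩
      exact ⟨p - q, by rwa [hsub, sub_sub_eq_add_sub, add_comm z]⟩
    · rintro ⟨p, hp⟩
      refine ⟨p + q, ?_⟩
      rwa [show ι p = ι (p + q) - ι q by rw [← hsub, add_sub_cancel_right],
        sub_sub_eq_add_sub, add_comm z] at hp
  -- `U` is invariant under a dense set of translations, so it is null or conull.
  have hconst := aeconst_of_dense_setOf_preimage_add_eq (μ := volume) hU.nullMeasurableSet
    (hι.mono (range_subset_iff.2 hinv))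
  have hBU : B ⊆ U := fun z hz => mem_iUnion.2 ⟨0, by simpa [ι, Prod.map, ← Prod.zero_eq_mk] using hz⟩
  obtain ⟨e⟩ : Nonempty (ℕ ≃ ℚ × ℚ) := ⟨(Denumerable.eqv (ℚ × ℚ)).symm⟩
  refine ⟨fun n => ι (e n), ?_⟩
  rcases eventuallyConst_set.1 hconst with h | h
  · filter_upwards [h] with z hz
    obtain ⟨q, hq⟩ := mem_iUnion.1 hz
    exact ⟨e.symm q, by simpa using hq⟩
  · exact absurd (measure_mono_null hBU (measure_eq_zero_iff_ae_notMem.2 h)) hB0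

/-- Patching translates turns a counterexample into a bithick one. -/
lemma exists_bithick_graphMeasurable_torus {A : Set (UnitAddCircle × UnitAddCircle)}
    (hA : ¬ NullMeasurableSet A volume) (hg : GraphMeasurable volume A) :
    ∃ A' : Set (UnitAddCircle × UnitAddCircle), Bithick volume A' ∧ GraphMeasurable volume A' := by
  obtain ⟨B, hB, hB0, hBA⟩ := exists_measurableSet_relatively_bithick hA
  obtain ⟨g, hcover⟩ := exists_translates_cover_torus hB hB0
  -- Disjoint pieces ensure that just one translate of `A` is used at each point.
  let P : ℕ → Set (UnitAddCircle × UnitAddCircle) :=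
    disjointed fun n => (fun z => z - g n) ⁻¹' B
  have hP : ∀ n, MeasurableSet (P n) :=
    MeasurableSet.disjointed fun n => measurable_id.sub_const _ hB
  have hPB : ∀ n, ∀ z ∈ P n, z - g n ∈ B := fun n z hz => disjointed_subset _ n hz
  have hdisj : ∀ {m n z}, z ∈ P m → z ∈ P n → m = n := fun {m n z} hm hn =>
    by_contra fun h => disjoint_left.1 (disjoint_disjointed _ h) hm hn
  have hPcover : ∀ᵐ z, z ∈ ⋃ n, P n := by
    simpa [P, iUnion_disjointed] using hcover
  refine ⟨{z | ∃ n, z ∈ P n ∧ z - g n ∈ A}, fun C hC hCA => ?_, fun f hf => ?_⟩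
  · have hpiece : ∀ n, volume (C ∩ P n) = 0 := by
      intro n
      have hpre : C ∩ P n = (fun z => z - g n) ⁻¹' ((fun z => z + g n) ⁻¹' (C ∩ P n)) := by
        ext z; simp
      have hm : MeasurableSet ((fun z => z + g n) ⁻¹' (C ∩ P n)) :=
        measurable_id.add_const _ (hC.inter (hP n))
      rw [hpre, (measurePreserving_sub_right volume (g n)).measure_preimage hm.nullMeasurableSet]
      refine hBA _ hm (fun z hz => ?_) (hCA.imp (fun h z hz => ?_) fun h z hz hzA => ?_)
      · simpa using hPB n _ hz.2
      · obtain ⟨m, hm, hmA⟩ := h hz.1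
        rw [hdisj hm hz.2] at hmA
        simpa using hmA
      · exact h hz.1 ⟨n, hz.2, by simpa using hzA⟩
    refine measure_mono_null (fun z hz => ?_) (measure_union_null (measure_iUnion_null hpiece)
      (ae_iff.1 hPcover))
    by_cases h : z ∈ ⋃ n, P n
    · obtain ⟨n, hn⟩ := mem_iUnion.1 h
      exact Or.inl (mem_iUnion.2 ⟨n, hz, hn⟩)
    · exact Or.inr h
  · have heq : {x | (x, f x) ∈ {z | ∃ n, z ∈ P n ∧ z - g n ∈ A}} =
        ⋃ n, (fun x => (x, f x)) ⁻¹' P n ∩ (fun x => x - (g n).1) ⁻¹'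
          {x | (x, f (x + (g n).1) - (g n).2) ∈ A} := by
      ext x
      simp [Prod.sub_def]
    rw [heq]
    refine .iUnion fun n => (measurable_id.prodMk hf (hP n)).nullMeasurableSet.inter ?_
    exact (hg _ ((hf.comp (measurable_id.add_const _)).sub_const _)).preimage
      (measurePreserving_sub_right volume (g n).1).quasiMeasurePreserving

/-! ### The equivalences -/

/-- Superposition measurability only has to be tested for indicators and Borel functions. -/
lemma forall_supMeasurable_nullMeasurable_iff :
    (∀ f : ℝ × ℝ → ℝ, SupMeasurable f → NullMeasurable f volume) ↔
      ∀ A : Set (ℝ × ℝ), GraphMeasurable volume A → NullMeasurableSet A volume := by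
  classical
  constructor
  · intro h A hA
    have hsup : SupMeasurable (A.indicator fun _ => 1) := by
      intro g hg
      obtain ⟨g', hg', hgg'⟩ : AEMeasurable g volume := hg.aemeasurable
      refine (NullMeasurable.congr (f := fun x => {x | (x, g' x) ∈ A}.indicator (fun _ => 1) x)
        ((aemeasurable_const.indicator₀ (hA g' hg')).nullMeasurable) ?_)
      filter_upwards [hgg'] with x hx
      simp [indicator, hx]
    have := h _ hsup (measurableSet_singleton 1)
    convert! this using 1
    ext z
    simp [indicator]
  · intro h f hf s hs
    exact h _ fun g hg => hf g hg.nullMeasurable hs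

theorem lemma3p1 (φ : ℕ → ℕ → ℕ) (hφ : IsGrowthSystem φ) :
    List.TFAE [
      ∀ f : ℝ × ℝ → ℝ, SupMeasurable f → NullMeasurable f volume,
      ∀ A : Set (ℝ × ℝ), ¬ NullMeasurableSet A volume →
        ∃ f : ℝ → ℝ, Measurable f ∧ ¬ NullMeasurableSet {x | (x, f x) ∈ A} volume,
      ∀ A : Set (CantorSpace × CantorSpace),
        ¬ NullMeasurableSet A (cantorMeasure.prod cantorMeasure) →
        ∃ f : CantorSpace → CantorSpace, Measurable f ∧
          ¬ NullMeasurableSet {x | (x, f x) ∈ A} cantorMeasure,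
      ∀ A : Set (BoxSpace φ × CantorSpace),
        (boxMeasure φ).prod cantorMeasure A = 1 →
        innerMeasure ((boxMeasure φ).prod cantorMeasure) A = 0 →
        ∃ h : BoxSpace φ → CantorSpace, Measurable h ∧
          ¬ NullMeasurableSet {x | (x, h x) ∈ A} (boxMeasure φ)] := by
  obtain ⟨eC⟩ := nonempty_aeIso_volume cantorMeasure
  obtain ⟨eB⟩ := nonempty_aeIso cantorMeasure (boxMeasure φ)
  obtain ⟨eTB⟩ := nonempty_aeIso (volume : Measure UnitAddCircle) (boxMeasure φ)
  obtain ⟨eTC⟩ := nonempty_aeIso (volume : Measure UnitAddCircle) cantorMeasure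
  have contra : ∀ {X Y : Type} [MeasurableSpace X] [MeasurableSpace Y] (μ : Measure X)
      (A : Set (X × Y)), (∃ f : X → Y, Measurable f ∧ ¬ NullMeasurableSet {x | (x, f x) ∈ A} μ) ↔
        ¬ GraphMeasurable μ A := by
    intro X Y _ _ μ A
    simp [GraphMeasurable]
  simp only [contra, not_imp_not]
  tfae_have 1 ↔ 2 := forall_supMeasurable_nullMeasurable_iff
  tfae_have 2 → 3 := graphMeasurable_imp_nullMeasurableSet_transfer eC.symm eC.symm
  tfae_have 3 → 4 := fun h A h1 h0 hA =>
    not_nullMeasurableSet_of_innerMeasure_lt (by simp [h1, h0])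
      (graphMeasurable_imp_nullMeasurableSet_transfer eB
        (.ofAbsolutelyContinuous .rfl .rfl) h A hA)
  tfae_have 4 → 2 := by
    intro h
    refine graphMeasurable_imp_nullMeasurableSet_transfer (eTC.trans eC) (eTC.trans eC)
      fun A hA => by_contra fun hAn => ?_
    obtain ⟨A', hthick, hgraph⟩ := exists_bithick_graphMeasurable_torus hAn hA
    have hthick' := hthick.transfer (eTB.prodMap eTC)
    exact h _ hthick'.measure_eq_one hthick'.innerMeasure_eq_zero (hgraph.transfer eTB eTC)
  tfae_finish
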